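/- Let $R$ be a commutative noetherian ring and let $C$ be a semidualizing $R$-module, i.e. a finitely generated $R$-module such that the homothety map $R\to\operatorname{Hom}_R(C,C)$ is an isomorphism and $\operatorname{Ext}^i_R(C,C)=0$ for all $i\ge 1$. Let $\mathcal P_C(R)$ (respectively $\mathcal F_C(R)$) be the class of $R$-modules isomorphic to $P\otimes_R C$ with $P$ projective (respectively to $F\otimes_R C$ with $F$ flat). For $\mathcal X\in\{\mathcal P_C(R),\mathcal F_C(R)\}$, a proper $\mathcal X$-resolution of an $R$-module $M$ is a complex $X=(\cdots\to X_1\to X_0\to 0)$ of modules in $\mathcal X$ together with an augmentation $X_0\to M$ such that $\cdots\to X_1\to X_0\to M\to 0$ is a complex that becomes exact after applying $\operatorname{Hom}_R(Y,-)$ for every $Y\in\mathcal X$. For $R$-modules $M,N$ and $i\ge 0$, set $\operatorname{Tor}^{\mathcal P_C\mathcal M}_i(M,N)=\operatorname{H}_i(Q\otimes_R N)$ and $\operatorname{Tor}^{\mathcal F_C\mathcal M}_i(M,N)=\operatorname{H}_i(G\otimes_R N)$, where $Q$ is any proper $\mathcal P_C(R)$-resolution and $G$ any proper $\mathcal F_C(R)$-resolution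 of $M$. The Bass class $\mathcal B_C(R)$ consists of the $R$-modules $M$ such that $\operatorname{Ext}^i_R(C,M)=0=\operatorname{Tor}^R_i(C,\operatorname{Hom}_R(C,M))$ for all $i\ge 1$ and the evaluation map $C\otimes_R\operatorname{Hom}_R(C,M)\to M$ is an isomorphism. The Auslander class $\mathcal A_C(R)$ consists of the $R$-modules $N$ such that $\operatorname{Tor}^R_i(C,N)=0=\operatorname{Ext}^i_R(C,C\otimes_R N)$ for all $i\ge 1$ and the natural map $N\to\operatorname{Hom}_R(C,C\otimes_R N)$ is an isomorphism. If $M\in\mathcal B_C(R)$ and $N\in\mathcal A_C(R)$, then for each $i\ge 0$, and for every choice of the proper resolutions $Q$ and $G$ of $M$, there are isomorphisms of $R$-modules $$\operatorname{Tor}^{\mathcal P_C\mathcal M}_i(M,N)\cong\operatorname{Tor}^R_i(M,N),\qquad \operatorname{Tor}^{\mathcal F_C\mathcal M}_i(M,N)\cong\operatorname{Tor}^R_i(M,N).$$ -/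

import Mathlib

open CategoryTheory

universe u

noncomputable section

namespace RelTor

variable {R : Type u} [CommRing R]

/-- A semidualizing module: finitely generated, with bijective homothety map `R → Hom_R(C, C)`,
`r ↦ (c ↦ r • c)`, and with `Ext^i_R(C, C) = 0` for all `i ≥ 1`. -/
structure IsSemidualizing (C : ModuleCat.{u} R) : Prop where
  finite : Module.Finite R C
  bijective_homothety : Function.Bijective (fun r : R => (LinearMap.lsmul R C r : C →ₗ[R] C))
  ext_eq_zero : ∀ i : ℕ, 1 ≤ i → Subsingleton (Abelian.Ext C C i)

/-- The natural map `M → Hom_R(C, C ⊗ M)`, `m ↦ (c ↦ c ⊗ m)`. -/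
def auslanderUnit (C M : ModuleCat.{u} R) : M →ₗ[R] C →ₗ[R] TensorProduct R C M :=
  (TensorProduct.mk R C M).flip

/-- The natural evaluation map `C ⊗ Hom_R(C, M) → M`, `c ⊗ f ↦ f c`. -/
def bassEval (C M : ModuleCat.{u} R) : TensorProduct R C (C →ₗ[R] M) →ₗ[R] M :=
  TensorProduct.lift LinearMap.applyₗ

/-- The Auslander class `𝒜_C(R)`. -/
structure AuslanderClass (C M : ModuleCat.{u} R) : Prop where
  tor_eq_zero : ∀ i : ℕ, 1 ≤ i → Limits.IsZero (((Tor (ModuleCat.{u} R) i).obj C).obj M)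
  ext_eq_zero : ∀ i : ℕ, 1 ≤ i →
    Subsingleton (Abelian.Ext C (ModuleCat.of R (TensorProduct R C M)) i)
  bijective : Function.Bijective (auslanderUnit C M)

/-- The Bass class `ℬ_C(R)`. -/
structure BassClass (C M : ModuleCat.{u} R) : Prop where
  ext_eq_zero : ∀ i : ℕ, 1 ≤ i → Subsingleton (Abelian.Ext C M i)
  tor_eq_zero : ∀ i : ℕ, 1 ≤ i →
    Limits.IsZero (((Tor (ModuleCat.{u} R) i).obj C).obj (ModuleCat.of R (C →ₗ[R] M)))
  bijective : Function.Bijective (bassEval C M)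

/-- The class `𝒫_C(R)` of `C`-projective modules: those isomorphic to `P ⊗ C`, `P` projective. -/
def CProjective (C : ModuleCat.{u} R) : ObjectProperty (ModuleCat.{u} R) := fun X =>
  ∃ P : ModuleCat.{u} R, Module.Projective R P ∧ Nonempty (X ≃ₗ[R] TensorProduct R P C)

/-- The class `ℱ_C(R)` of `C`-flat modules: those isomorphic to `F ⊗ C` with `F` flat. -/
def CFlat (C : ModuleCat.{u} R) : ObjectProperty (ModuleCat.{u} R) := fun X =>
  ∃ F : ModuleCat.{u} R, Module.Flat R F ∧ Nonempty (X ≃ₗ[R] TensorProduct R F C)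

/-- A proper `𝒳`-resolution of `M`: a complex `⋯ → X₁ → X₀ → 0` of modules in `𝒳` with an
augmentation `X₀ → M` such that the augmented complex `⋯ → X₁ → X₀ → M → 0` becomes exact after
applying `Hom(Y, -)` for every `Y` in `𝒳`. The augmented complex itself need not be exact. -/
structure ProperResolution (𝒳 : ObjectProperty (ModuleCat.{u} R)) (M : ModuleCat.{u} R) where
  complex : ChainComplex (ModuleCat.{u} R) ℕ
  mem : ∀ n, 𝒳 (complex.X n)
  aug : complex.X 0 ⟶ M
  d_comp_aug : complex.d 1 0 ≫ aug = 0
  /-- exactness of `Hom(Y, X⁺)` at `Hom(Y, M)` -/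
  hom_exact_aug : ∀ Y, 𝒳 Y → ∀ f : Y ⟶ M, ∃ g : Y ⟶ complex.X 0, g ≫ aug = f
  /-- exactness of `Hom(Y, X⁺)` at `Hom(Y, X₀)` -/
  hom_exact_zero : ∀ Y, 𝒳 Y → ∀ f : Y ⟶ complex.X 0, f ≫ aug = 0 →
    ∃ g : Y ⟶ complex.X 1, g ≫ complex.d 1 0 = f
  /-- exactness of `Hom(Y, X⁺)` at `Hom(Y, Xₙ₊₁)` -/
  hom_exact_succ : ∀ Y, 𝒳 Y → ∀ (n : ℕ) (f : Y ⟶ complex.X (n + 1)),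
    f ≫ complex.d (n + 1) n = 0 →
    ∃ g : Y ⟶ complex.X (n + 2), g ≫ complex.d (n + 2) (n + 1) = f

/-- The relative Tor module `H_i(Q ⊗ N)` computed from a proper `𝒳`-resolution `Q` of the first
argument. -/
def relTor {𝒳 : ObjectProperty (ModuleCat.{u} R)} {M : ModuleCat.{u} R}
    (Q : ProperResolution 𝒳 M) (N : ModuleCat.{u} R) (i : ℕ) : ModuleCat.{u} R :=
  (((MonoidalCategory.tensorRight N).mapHomologicalComplex
    (ComplexShape.down ℕ)).obj Q.complex).homology i

end RelTor

end

/-! Both classes contain `C` and consist of modules `F ⊗ C` with `F` flat, so one argument serves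
both. Let `X` be a proper resolution of `M`. Properness, tested at `Y = C`, makes `Hom(C, X)` a
resolution of `Hom(C, M)`. Its terms are flat, since `Hom(C, F ⊗ C) ≅ F` by tensor evaluation and
the homothety isomorphism. Hence `C ⊗ Hom(C, X)` computes `Tor(C, Hom(C, M))`. The evaluation map
identifies this complex with `X`, and `M` lies in the Bass class, so `X → M` is a genuine resolution
(`BassClass.isResolution`).

Since `Tor_j(F ⊗ C, N) ≅ F ⊗ Tor_j(C, N) = 0` for `j ≥ 1`, the terms of `X` are acyclic for `- ⊗ N`.
Dimension shifting then gives `H_i(X ⊗ N) ≅ Tor_i(M, N)`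
(`IsResolution.nonempty_homology_tensor_iso_tor`). -/

noncomputable section

namespace RelTor

open scoped TensorProduct

/-! ### Tensor evaluation. -/

section TensorHom

variable {R : Type*} [CommRing R] {C F N : Type*} [AddCommGroup C] [AddCommGroup F]
  [AddCommGroup N] [Module R C] [Module R F] [Module R N]

theorem lTensorHomToHomLTensor_bijective_fun (n : ℕ) :
    Function.Bijective
      (TensorProduct.lTensorHomToHomLTensor (RingHom.id R) (Fin n → R) F N) := by
  have h : TensorProduct.lTensorHomToHomLTensor (RingHom.id R) (Fin n → R) F N =
      (((Pi.basisFun R (Fin n)).constr R).symm.lTensor F ≪≫ₗ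
        TensorProduct.piRight R R F (fun _ : Fin n => N) ≪≫ₗ
        (Pi.basisFun R (Fin n)).constr R).toLinearMap := by
    refine TensorProduct.ext' fun x f => (Pi.basisFun R (Fin n)).ext fun i => ?_
    simp [Module.Basis.constr_symm_apply]
  rw [h]
  exact LinearEquiv.bijective _

/-- Tensor evaluation `F ⊗ Hom(C, N) → Hom(C, F ⊗ N)` is bijective for `F` flat and `C` finitely
presented. -/
theorem lTensorHomToHomLTensor_bijective [Module.FinitePresentation R C] [Module.Flat R F] :
    Function.Bijective (TensorProduct.lTensorHomToHomLTensor (RingHom.id R) C F N) := by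
  obtain ⟨n, m, f, g, hf, hfg⟩ := Module.FinitePresentation.exists_fin' R C
  -- A presentation `R^m → R^n → C → 0` turns both sides into kernels of maps between the free
  -- cases; flatness of `F` keeps the source left exact.
  refine LinearMap.bijective_of_bijective_of_injective_of_left_exact
    ((LinearMap.lcomp R N f).lTensor F) ((LinearMap.lcomp R N g).lTensor F)
    (LinearMap.lcomp R (TensorProduct R F N) f) (LinearMap.lcomp R (TensorProduct R F N) g)
    _ (TensorProduct.lTensorHomToHomLTensor (RingHom.id R) (Fin n → R) F N)
    (TensorProduct.lTensorHomToHomLTensor (RingHom.id R) (Fin m → R) F N)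
    ?_ ?_ ?_ ?_ ?_ ?_ ?_ ?_
  · exact TensorProduct.ext' fun x φ => by ext; simp
  · exact TensorProduct.ext' fun x φ => by ext; simp
  · exact Module.Flat.lTensor_exact F (LinearMap.exact_lcomp_of_exact_of_surjective _ hfg hf)
  · exact LinearMap.exact_lcomp_of_exact_of_surjective _ hfg hf
  · exact lTensorHomToHomLTensor_bijective_fun n
  · exact (lTensorHomToHomLTensor_bijective_fun m).1
  · exact Module.Flat.lTensor_preserves_injective_linearMap _
      (LinearMap.lcomp_injective_of_surjective f hf)
  · exact LinearMap.lcomp_injective_of_surjective f hf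

end TensorHom

/-! ### `C`-flat modules under `Hom(C, -)`. -/

variable {R : Type u} [CommRing R]

/-- After `F ≅ F ⊗ R ≅ F ⊗ Hom(C, C)`, the unit becomes tensor evaluation with `N = C`. -/
theorem auslanderUnit_bijective_of_flat (C F : ModuleCat.{u} R) [Module.FinitePresentation R C]
    [Module.Flat R F]
    (hC : Function.Bijective (fun r : R => (LinearMap.lsmul R C r : C →ₗ[R] C))) :
    Function.Bijective (auslanderUnit C F) := by
  let e : R ≃ₗ[R] (C →ₗ[R] C) := LinearEquiv.ofBijective
    { toFun := fun r => LinearMap.lsmul R C r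
      map_add' := fun _ _ => by simp
      map_smul' := fun _ _ => by ext; simp [mul_smul] } hC
  have h : auslanderUnit C F = ((TensorProduct.comm R F C).congrRight).toLinearMap ∘ₗ
      TensorProduct.lTensorHomToHomLTensor (RingHom.id R) C F C ∘ₗ
      ((TensorProduct.rid R F).symm ≪≫ₗ e.lTensor F).toLinearMap := by
    ext x c
    simp only [auslanderUnit, e, LinearMap.coe_comp, Function.comp_apply, LinearEquiv.coe_coe,
      LinearEquiv.trans_apply, TensorProduct.rid_symm_apply, LinearEquiv.lTensor_tmul,
      LinearMap.flip_apply, TensorProduct.mk_apply]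
    change c ⊗ₜ[R] x = TensorProduct.comm R F C (x ⊗ₜ[R] ((1 : R) • c))
    simp
  rw [h, LinearMap.coe_comp, LinearMap.coe_comp]
  exact (LinearEquiv.bijective _).comp
    (lTensorHomToHomLTensor_bijective.comp (LinearEquiv.bijective _))

variable {C : ModuleCat.{u} R}

/-- The functor `Hom_R(C, -)` with values in `R`-modules. -/
abbrev homFunctor (C : ModuleCat.{u} R) : ModuleCat.{u} R ⥤ ModuleCat.{u} R where
  obj M := ModuleCat.of R (C →ₗ[R] M)
  map f := ModuleCat.ofHom (f.hom.compRight R)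

instance : (homFunctor C).Additive where
  map_add := by intros; ext; simp

/-- The evaluation `C ⊗ Hom_R(C, -) → 𝟭` as a natural transformation. -/
def evalNatTrans (C : ModuleCat.{u} R) :
    homFunctor C ⋙ MonoidalCategory.tensorLeft C ⟶ 𝟭 (ModuleCat.{u} R) where
  app M := ModuleCat.ofHom (bassEval C M)
  naturality M N f := by
    ext : 1
    exact TensorProduct.ext' fun c φ => rfl

section

variable [Module.FinitePresentation R C]
    (hC : Function.Bijective (fun r : R => (LinearMap.lsmul R C r : C →ₗ[R] C)))

include hC

/-- For `X ≅ C ⊗ F`, the triangle identity says that evaluation composed with `C ⊗ (unit)` is the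
given isomorphism `C ⊗ F ≅ X`. -/
theorem CFlat.exists_equiv {X : ModuleCat.{u} R} (hX : CFlat C X) :
    ∃ (F : ModuleCat.{u} R) (e : F ≃ₗ[R] (C →ₗ[R] X)), Module.Flat R F ∧
      Function.Bijective (bassEval C X ∘ₗ e.toLinearMap.lTensor C) := by
  obtain ⟨F, hF, ⟨a⟩⟩ := hX
  let b : TensorProduct R C F ≃ₗ[R] X := TensorProduct.comm R C F ≪≫ₗ a.symm
  let e : F ≃ₗ[R] (C →ₗ[R] X) :=
    LinearEquiv.ofBijective _ (auslanderUnit_bijective_of_flat C F hC) ≪≫ₗ b.congrRight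
  have h : bassEval C X ∘ₗ e.toLinearMap.lTensor C = b.toLinearMap :=
    TensorProduct.ext' fun c x => rfl
  exact ⟨F, e, hF, h ▸ b.bijective⟩

theorem CFlat.flat_hom {X : ModuleCat.{u} R} (hX : CFlat C X) : Module.Flat R (C →ₗ[R] X) := by
  obtain ⟨F, e, hF, -⟩ := CFlat.exists_equiv hC hX
  exact Module.Flat.of_linearEquiv e.symm

theorem CFlat.bassEval_bijective {X : ModuleCat.{u} R} (hX : CFlat C X) :
    Function.Bijective (bassEval C X) := by
  obtain ⟨F, e, -, h⟩ := CFlat.exists_equiv hC hX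
  have : (bassEval C X ∘ₗ e.toLinearMap.lTensor C) = bassEval C X ∘ e.lTensor C := rfl
  rw [this] at h
  exact (Function.Bijective.of_comp_iff _ (e.lTensor C).bijective).1 h

end

end RelTor

/-! ### Acyclic resolutions compute Tor. -/

namespace RelTor

open Limits MonoidalCategory

variable {R : Type u} [CommRing R]

/-- The complex `M ⊗ P`. -/
abbrev tensorComplex (M : ModuleCat.{u} R) (P : ChainComplex (ModuleCat.{u} R) ℕ) :
    ChainComplex (ModuleCat.{u} R) ℕ :=
  (((tensoringLeft (ModuleCat.{u} R)).obj M).mapHomologicalComplex (ComplexShape.down ℕ)).obj P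

/-- The map of complexes `f ⊗ P`. -/
abbrev tensorComplexMap {M M' : ModuleCat.{u} R} (f : M ⟶ M')
    (P : ChainComplex (ModuleCat.{u} R) ℕ) : tensorComplex M P ⟶ tensorComplex M' P :=
  (NatTrans.mapHomologicalComplex ((tensoringLeft (ModuleCat.{u} R)).map f)
    (ComplexShape.down ℕ)).app P

theorem tensorComplexMap_comp_eq_zero {S : ShortComplex (ModuleCat.{u} R)}
    (P : ChainComplex (ModuleCat.{u} R) ℕ) :
    tensorComplexMap S.f P ≫ tensorComplexMap S.g P = 0 := by
  ext n : 1
  change S.f ▷ P.X n ≫ S.g ▷ P.X n = 0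
  rw [← comp_whiskerRight, S.zero]
  exact (tensorRight (P.X n)).map_zero _ _

/-- The short complex of complexes `S ⊗ P`. -/
abbrev tensorShortComplex (S : ShortComplex (ModuleCat.{u} R))
    (P : ChainComplex (ModuleCat.{u} R) ℕ) :
    ShortComplex (ChainComplex (ModuleCat.{u} R) ℕ) :=
  ShortComplex.mk (tensorComplexMap S.f P) (tensorComplexMap S.g P)
    (tensorComplexMap_comp_eq_zero P)

theorem tensorShortComplex_shortExact {S : ShortComplex (ModuleCat.{u} R)} (hS : S.ShortExact)
    (P : ChainComplex (ModuleCat.{u} R) ℕ) [∀ n, Module.Flat R (P.X n)] :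
    (tensorShortComplex S P).ShortExact := by
  refine HomologicalComplex.shortExact_of_degreewise_shortExact _ fun n => ?_
  change (S.map (tensorRight (P.X n))).ShortExact
  have := (Module.Flat.iff_preservesFiniteLimits_tensorRight (P.X n)).1 inferInstance
  exact hS.map_of_exact (tensorRight (P.X n))

/-- `H₀(M ⊗ P) ≅ M ⊗ N` for a projective resolution `P` of `N`. -/
def homologyZeroIso {N : ModuleCat.{u} R} (P : ProjectiveResolution N) (M : ModuleCat.{u} R) :
    (tensorComplex M P.complex).homology 0 ≅ M ⊗ N :=
  (tensorComplex M P.complex).isoHomologyι₀ ≪≫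
    asIso (P.fromLeftDerivedZero' ((tensoringLeft (ModuleCat.{u} R)).obj M))

theorem homologyZeroIso_naturality {N : ModuleCat.{u} R} (P : ProjectiveResolution N)
    {M M' : ModuleCat.{u} R} (f : M ⟶ M') :
    HomologicalComplex.homologyMap (tensorComplexMap f P.complex) 0 ≫ (homologyZeroIso P M').hom =
      (homologyZeroIso P M).hom ≫ f ▷ N := by
  have h : HomologicalComplex.opcyclesMap (tensorComplexMap f P.complex) 0 ≫
      P.fromLeftDerivedZero' ((tensoringLeft (ModuleCat.{u} R)).obj M') =
      P.fromLeftDerivedZero' ((tensoringLeft (ModuleCat.{u} R)).obj M) ≫ f ▷ N := by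
    rw [← cancel_epi (HomologicalComplex.pOpcycles _ _),
      HomologicalComplex.p_opcyclesMap_assoc,
      ProjectiveResolution.pOpcycles_comp_fromLeftDerivedZero',
      ProjectiveResolution.pOpcycles_comp_fromLeftDerivedZero'_assoc]
    exact (whisker_exchange f (P.π.f 0)).symm
  simp only [homologyZeroIso, Iso.trans_hom, asIso_hom, Category.assoc, ← h]
  exact (HomologicalComplex.homologyι_naturality_assoc _ _ _)

/-- If the second arrow of a short complex factors through the cokernel of the first one, the
homology is the kernel of the induced map. -/
theorem nonempty_homology_iso_kernel {𝒞 : Type*} [Category 𝒞] [Abelian 𝒞] (S : ShortComplex 𝒞)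
    {Z : 𝒞} (p : S.X₂ ⟶ Z) (k : Z ⟶ S.X₃) (h : p ≫ k = S.g) (w : S.f ≫ p = 0)
    (hp : (ShortComplex.mk S.f p w).Exact) (hp' : Epi p) : Nonempty (S.homology ≅ kernel k) := by
  have hd : hp.gIsCokernel.desc (CokernelCofork.ofπ _ S.zero) = k := by
    rw [← cancel_epi p]
    exact (hp.gIsCokernel.fac _ WalkingParallelPair.one).trans h.symm
  exact ⟨ShortComplex.RightHomologyData.homologyIso
    { Q := Z, H := kernel (hp.gIsCokernel.desc (CokernelCofork.ofπ _ S.zero)), p := p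
      ι := kernel.ι _, wp := w, hp := hp.gIsCokernel
      wι := kernel.condition _
      hι := kernelIsKernel _ } ≪≫ kernelIsoOfEq hd⟩

variable {M : ModuleCat.{u} R} {X : ChainComplex (ModuleCat.{u} R) ℕ}

/-- `X`, augmented by `aug`, is a resolution of `M`. -/
structure IsResolution (X : ChainComplex (ModuleCat.{u} R) ℕ) (aug : X.X 0 ⟶ M) : Prop where
  surjective : Function.Surjective aug
  exact_zero : Function.Exact (X.d 1 0) aug
  exact_succ : ∀ n, Function.Exact (X.d (n + 2) (n + 1)) (X.d (n + 1) n)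

/-- The syzygies of an augmented complex: `M`, followed by the images of the differentials. -/
def syzygy (M : ModuleCat.{u} R) (X : ChainComplex (ModuleCat.{u} R) ℕ) : ℕ → ModuleCat.{u} R
  | 0 => M
  | n + 1 => ModuleCat.of R (LinearMap.range (X.d (n + 1) n).hom)

/-- The inclusion of a syzygy. -/
def syzygyι (M : ModuleCat.{u} R) (X : ChainComplex (ModuleCat.{u} R) ℕ) (n : ℕ) :
    syzygy M X (n + 1) ⟶ X.X n :=
  ModuleCat.ofHom (LinearMap.range (X.d (n + 1) n).hom).subtype

/-- The projection onto a syzygy. -/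
def syzygyπ (aug : X.X 0 ⟶ M) : ∀ n : ℕ, X.X n ⟶ syzygy M X n
  | 0 => aug
  | n + 1 => ModuleCat.ofHom (X.d (n + 1) n).hom.rangeRestrict

namespace IsResolution

variable {aug : X.X 0 ⟶ M} (h : IsResolution X aug)

include h

theorem syzygyπ_surjective : ∀ n, Function.Surjective (syzygyπ aug n)
  | 0 => h.surjective
  | n + 1 => (X.d (n + 1) n).hom.surjective_rangeRestrict

theorem exact_syzygyπ : ∀ n, Function.Exact (X.d (n + 1) n) (syzygyπ aug n)
  | 0 => h.exact_zero
  | n + 1 => fun x => (Subtype.ext_iff).trans (h.exact_succ n x)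

theorem d_comp_syzygyπ (n : ℕ) : X.d (n + 1) n ≫ syzygyπ aug n = 0 := by
  ext x
  exact (h.exact_syzygyπ n).apply_apply_eq_zero x

theorem syzygyι_comp_syzygyπ (n : ℕ) : syzygyι M X n ≫ syzygyπ aug n = 0 := by
  ext ⟨_, x, rfl⟩
  exact (h.exact_syzygyπ n).apply_apply_eq_zero x

/-- The short exact sequence `0 → Zₙ₊₁ → Xₙ → Zₙ → 0`. -/
abbrev syzygySequence (n : ℕ) : ShortComplex (ModuleCat.{u} R) :=
  ShortComplex.mk (syzygyι M X n) (syzygyπ aug n) (h.syzygyι_comp_syzygyπ n)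

theorem syzygySequence_shortExact (n : ℕ) : (h.syzygySequence n).ShortExact := by
  refine ModuleCat.shortComplex_shortExact _ (fun x => ?_) Subtype.val_injective
    (h.syzygyπ_surjective n)
  refine (h.exact_syzygyπ n x).trans ⟨?_, ?_⟩
  · rintro ⟨y, rfl⟩
    exact ⟨⟨_, y, rfl⟩, rfl⟩
  · rintro ⟨⟨_, y, rfl⟩, rfl⟩
    exact ⟨y, rfl⟩

variable (P : ChainComplex (ModuleCat.{u} R) ℕ) [∀ n, Module.Flat R (P.X n)]
  (hX : ∀ n j, IsZero ((tensorComplex (X.X n) P).homology (j + 1)))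

-- Dimension shifting: the long exact sequence of `0 → Zₙ₊₁ → Xₙ → Zₙ → 0` tensored with `P` has
-- vanishing middle terms in positive degrees.
include hX in
theorem nonempty_homology_iso_syzygy (n j : ℕ) :
    Nonempty ((tensorComplex M P).homology (n + j + 1) ≅
      (tensorComplex (syzygy M X n) P).homology (j + 1)) := by
  induction n generalizing j with
  | zero => rw [zero_add]; exact ⟨Iso.refl _⟩
  | succ n ih =>
    obtain ⟨e⟩ := ih (j + 1)
    rw [show n + 1 + j + 1 = n + (j + 1) + 1 by omega]
    exact ⟨e ≪≫ (tensorShortComplex_shortExact (h.syzygySequence_shortExact n) P).δIso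
      (j + 1 + 1) (j + 1) rfl (hX n _) (hX n _)⟩

/-- After shifting down to `H₁(Zₙ ⊗ P)`, the vanishing of `H₁(Xₙ ⊗ P)` makes the connecting map
identify it with the kernel of `H₀(Zₙ₊₁ ⊗ P) → H₀(Xₙ ⊗ P)`. -/
theorem nonempty_homology_iso_kernel_syzygyι {N : ModuleCat.{u} R} (P : ProjectiveResolution N)
    (hX : ∀ n j, IsZero ((tensorComplex (X.X n) P.complex).homology (j + 1))) (n : ℕ) :
    Nonempty ((tensorComplex M P.complex).homology (n + 1) ≅ kernel (syzygyι M X n ▷ N)) := by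
  have : ∀ n, Module.Flat R (P.complex.X n) := fun n =>
    have : Module.Projective R (P.complex.X n) :=
      (IsProjective.iff_projective _).2 (P.projective n)
    inferInstance
  obtain ⟨e⟩ := h.nonempty_homology_iso_syzygy P.complex hX n 0
  have hS := tensorShortComplex_shortExact (h.syzygySequence_shortExact n) P.complex
  have := hS.mono_δ 1 0 rfl (hX n 0)
  exact ⟨e ≪≫ (hS.homology_exact₁ 1 0 rfl).fIsKernel.conePointUniqueUpToIso (kernelIsKernel _) ≪≫
    kernel.mapIso _ _ (homologyZeroIso P _) (homologyZeroIso P _)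
      (homologyZeroIso_naturality P _)⟩

theorem epi_syzygyπ_whiskerRight (N : ModuleCat.{u} R) (n : ℕ) : Epi (syzygyπ aug n ▷ N) :=
  (ModuleCat.epi_iff_surjective _).2 (LinearMap.rTensor_surjective N (h.syzygyπ_surjective n))

theorem d_whiskerRight_comp (N : ModuleCat.{u} R) (n : ℕ) :
    X.d (n + 1) n ▷ N ≫ syzygyπ aug n ▷ N = 0 := by
  rw [← comp_whiskerRight, h.d_comp_syzygyπ]
  exact (tensorRight N).map_zero _ _

theorem exact_d_whiskerRight (N : ModuleCat.{u} R) (n : ℕ) :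
    (ShortComplex.mk _ _ (h.d_whiskerRight_comp N n)).Exact := by
  rw [ShortComplex.ShortExact.moduleCat_exact_iff_function_exact]
  exact _root_.rTensor_exact N (h.exact_syzygyπ n) (h.syzygyπ_surjective n)

/-- By right exactness `Zₙ₊₁ ⊗ N` is the cokernel of the incoming differential, and the outgoing one
factors through it. No acyclicity is needed. -/
theorem nonempty_homology_tensor_iso_kernel_syzygyι (N : ModuleCat.{u} R) (n : ℕ) :
    Nonempty ((((tensorRight N).mapHomologicalComplex (ComplexShape.down ℕ)).obj X).homology
      (n + 1) ≅ kernel (syzygyι M X n ▷ N)) := by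
  obtain ⟨e⟩ := nonempty_homology_iso_kernel
    ((((tensorRight N).mapHomologicalComplex (ComplexShape.down ℕ)).obj X).sc' (n + 2) (n + 1) n)
    (syzygyπ aug (n + 1) ▷ N) (syzygyι M X n ▷ N)
    ((comp_whiskerRight _ _ _).symm) (h.d_whiskerRight_comp N (n + 1))
    (h.exact_d_whiskerRight N (n + 1)) (h.epi_syzygyπ_whiskerRight N (n + 1))
  exact ⟨HomologicalComplex.homologyIsoSc' _ _ _ _ (by simp) (by simp) ≪≫ e⟩

theorem nonempty_homology_zero_tensor_iso (N : ModuleCat.{u} R) :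
    Nonempty ((((tensorRight N).mapHomologicalComplex (ComplexShape.down ℕ)).obj X).homology 0 ≅
      M ⊗ N) := by
  have := h.epi_syzygyπ_whiskerRight N 0
  let K := ((tensorRight N).mapHomologicalComplex (ComplexShape.down ℕ)).obj X
  exact ⟨ChainComplex.isoHomologyι₀ K ≪≫ (K.opcyclesIsCokernel 1 0 (by simp)).coconePointUniqueUpToIso
    (h.exact_d_whiskerRight N 0).gIsCokernel⟩

/-- An acyclic resolution computes `Tor`. -/
theorem nonempty_homology_tensor_iso_tor (N : ModuleCat.{u} R)
    (hX : ∀ n j, IsZero (((Tor (ModuleCat.{u} R) (j + 1)).obj (X.X n)).obj N)) (i : ℕ) :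
    Nonempty ((((tensorRight N).mapHomologicalComplex (ComplexShape.down ℕ)).obj X).homology i ≅
      ((Tor (ModuleCat.{u} R) i).obj M).obj N) := by
  let P := projectiveResolution N
  let e (M : ModuleCat.{u} R) (i : ℕ) : ((Tor (ModuleCat.{u} R) i).obj M).obj N ≅
      (tensorComplex M P.complex).homology i :=
    P.isoLeftDerivedObj ((tensoringLeft (ModuleCat.{u} R)).obj M) i
  cases i with
  | zero =>
    obtain ⟨a⟩ := h.nonempty_homology_zero_tensor_iso N
    exact ⟨a ≪≫ (homologyZeroIso P M).symm ≪≫ (e M 0).symm⟩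
  | succ n =>
    -- Both sides are the kernel of `Zₙ₊₁ ⊗ N → Xₙ ⊗ N`.
    obtain ⟨a⟩ := h.nonempty_homology_tensor_iso_kernel_syzygyι N n
    obtain ⟨b⟩ := h.nonempty_homology_iso_kernel_syzygyι P
      (fun n j => (hX n j).of_iso (e _ _).symm) n
    exact ⟨a ≪≫ b.symm ≪≫ (e M _).symm⟩

end IsResolution

end RelTor

/-! ### Flatness and balance of Tor; exactness over the Bass class. -/

namespace RelTor

open Limits MonoidalCategory

variable {R : Type u} [CommRing R]

theorem exactAt_tensorComplex (F : ModuleCat.{u} R) [Module.Flat R F]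
    {K : ChainComplex (ModuleCat.{u} R) ℕ} {i : ℕ} (hK : K.ExactAt i) :
    (tensorComplex F K).ExactAt i :=
  Module.Flat.lTensor_shortComplex_exact F (K.sc i) hK

/-- `Tor_i(M, N)` computed from a projective resolution of `N`. -/
def torIso {N : ModuleCat.{u} R} (P : ProjectiveResolution N) (M : ModuleCat.{u} R) (i : ℕ) :
    ((Tor (ModuleCat.{u} R) i).obj M).obj N ≅ (tensorComplex M P.complex).homology i :=
  P.isoLeftDerivedObj ((tensoringLeft (ModuleCat.{u} R)).obj M) i

theorem isZero_tor_iff {N : ModuleCat.{u} R} (P : ProjectiveResolution N) (M : ModuleCat.{u} R)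
    (i : ℕ) : IsZero (((Tor (ModuleCat.{u} R) i).obj M).obj N) ↔
      (tensorComplex M P.complex).ExactAt i := by
  rw [(torIso P M i).isZero_iff, HomologicalComplex.exactAt_iff_isZero_homology]

theorem isZero_tor_of_flat (F N : ModuleCat.{u} R) [Module.Flat R F] (i : ℕ) :
    IsZero (((Tor (ModuleCat.{u} R) (i + 1)).obj F).obj N) :=
  (isZero_tor_iff (projectiveResolution N) F _).2
    (exactAt_tensorComplex F ((projectiveResolution N).complex_exactAt_succ i))

/-- `(F ⊗ C) ⊗ P ≅ F ⊗ (C ⊗ P)`, and `F ⊗ -` preserves exactness. -/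
theorem isZero_tor_tensor_of_flat (F : ModuleCat.{u} R) [Module.Flat R F]
    {C N : ModuleCat.{u} R} {i : ℕ} (h : IsZero (((Tor (ModuleCat.{u} R) i).obj C).obj N)) :
    IsZero (((Tor (ModuleCat.{u} R) i).obj (F ⊗ C)).obj N) := by
  let P := projectiveResolution N
  rw [isZero_tor_iff P] at h ⊢
  let e : tensorComplex F (tensorComplex C P.complex) ≅ tensorComplex (F ⊗ C) P.complex :=
    HomologicalComplex.Hom.isoOfComponents (fun n => (α_ F C (P.complex.X n)).symm)
      fun i j _ => (associator_inv_naturality_right F C (P.complex.d i j)).symm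
  exact (exactAt_tensorComplex F h).of_iso e

theorem CFlat.isZero_tor {C N X : ModuleCat.{u} R} (hX : CFlat C X) {i : ℕ}
    (h : IsZero (((Tor (ModuleCat.{u} R) i).obj C).obj N)) :
    IsZero (((Tor (ModuleCat.{u} R) i).obj X).obj N) := by
  obtain ⟨F, hF, ⟨e⟩⟩ := hX
  let e' : X ≅ F ⊗ C := e.toModuleIso
  exact (isZero_tor_tensor_of_flat F h).of_iso (((Tor (ModuleCat.{u} R) i).mapIso e').app N)

theorem isResolution_projectiveResolution {M : ModuleCat.{u} R} (P : ProjectiveResolution M) :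
    IsResolution (M := M) P.complex (P.π.f 0) where
  surjective := (ModuleCat.epi_iff_surjective _).1 (inferInstanceAs (Epi (P.π.f 0)))
  exact_zero := (ShortComplex.ShortExact.moduleCat_exact_iff_function_exact _).1 P.exact₀
  exact_succ n :=
    (ShortComplex.ShortExact.moduleCat_exact_iff_function_exact _).1 (P.exact_succ n)

/-- The homology of `X ⊗ N` and `N ⊗ X` agree. -/
def homologyTensorRightIso (X : ChainComplex (ModuleCat.{u} R) ℕ) (N : ModuleCat.{u} R) (i : ℕ) :
    (((tensorRight N).mapHomologicalComplex (ComplexShape.down ℕ)).obj X).homology i ≅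
      (tensorComplex N X).homology i :=
  (HomologicalComplex.homologyFunctor _ _ i).mapIso
    ((NatIso.mapHomologicalComplex (BraidedCategory.tensorLeftIsoTensorRight N).symm _).app X)

/-- `Tor` is derived in its second variable; a projective resolution of `M` is an acyclic resolution
in the first, so it computes the same modules. -/
theorem nonempty_tor_symm (M N : ModuleCat.{u} R) (i : ℕ) :
    Nonempty (((Tor (ModuleCat.{u} R) i).obj M).obj N ≅
      ((Tor (ModuleCat.{u} R) i).obj N).obj M) := by
  let P := projectiveResolution M
  have (n : ℕ) : Module.Flat R (P.complex.X n) :=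
    have : Module.Projective R (P.complex.X n) :=
      (IsProjective.iff_projective _).2 (P.projective n)
    inferInstance
  obtain ⟨e⟩ := (isResolution_projectiveResolution P).nonempty_homology_tensor_iso_tor N
    (fun n j => isZero_tor_of_flat _ _ _) i
  exact ⟨e.symm ≪≫ homologyTensorRightIso P.complex N i ≪≫ (torIso P N i).symm⟩

section

variable {C M : ModuleCat.{u} R} {X : ChainComplex (ModuleCat.{u} R) ℕ}

/-- The complex `Hom_R(C, X)`. -/
abbrev homComplex (C : ModuleCat.{u} R) (X : ChainComplex (ModuleCat.{u} R) ℕ) :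
    ChainComplex (ModuleCat.{u} R) ℕ :=
  ((homFunctor C).mapHomologicalComplex (ComplexShape.down ℕ)).obj X

theorem nonempty_tensor_homComplex_iso
    (hev : ∀ n, Function.Bijective (bassEval C (X.X n))) :
    Nonempty (tensorComplex C (homComplex C X) ≅ X) := by
  have h (n : ℕ) : IsIso ((evalNatTrans C).app (X.X n)) :=
    (ConcreteCategory.isIso_iff_bijective _).2 (hev n)
  exact ⟨HomologicalComplex.Hom.isoOfComponents
    (fun n => @asIso _ _ _ _ ((evalNatTrans C).app (X.X n)) (h n))
    fun i j _ => ((evalNatTrans C).naturality (X.d i j)).symm⟩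

/-- If `M` is in the Bass class, a complex of `C`-flat modules over `M` that becomes exact under
`Hom_R(C, -)` is exact. -/
theorem BassClass.isResolution [Module.FinitePresentation R C]
    (hC : Function.Bijective (fun r : R => (LinearMap.lsmul R C r : C →ₗ[R] C)))
    (hM : BassClass C M) (hX : ∀ n, CFlat C (X.X n)) {aug : X.X 0 ⟶ M}
    (h : IsResolution (homComplex C X) ((homFunctor C).map aug)) : IsResolution X aug := by
  have hev (n : ℕ) := (hX n).bassEval_bijective hC
  have hflat (n : ℕ) : Module.Flat R ((homComplex C X).X n) := (hX n).flat_hom hC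
  obtain ⟨e⟩ := nonempty_tensor_homComplex_iso hev
  have hnat {A B : ModuleCat.{u} R} (f : A ⟶ B) :
      f.hom ∘ₗ bassEval C A = bassEval C B ∘ₗ ((homFunctor C).map f).hom.lTensor C :=
    TensorProduct.ext' fun _ _ => rfl
  refine ⟨?_, ?_, fun n => ?_⟩
  -- Naturality rewrites this composite as evaluation at `M` after `C ⊗ Hom(C, aug)`, both
  -- surjective.
  · have h1 : Function.Surjective (aug.hom ∘ₗ bassEval C (X.X 0)) := by
      rw [hnat]
      exact hM.bijective.2.comp (LinearMap.lTensor_surjective C h.surjective)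
    exact Function.Surjective.of_comp h1
  · exact Function.Exact.of_ladder_linearEquiv_of_exact
      (e₁ := LinearEquiv.ofBijective _ (hev 1)) (e₂ := LinearEquiv.ofBijective _ (hev 0))
      (e₃ := LinearEquiv.ofBijective _ hM.bijective) (hnat (X.d 1 0)) (hnat aug)
      (lTensor_exact C h.exact_zero h.surjective)
  -- The flat resolution gives `Tor(Hom(C, M), C)`; symmetry brings it to the form that vanishes in
  -- the Bass class.
  · obtain ⟨a⟩ := h.nonempty_homology_tensor_iso_tor C (fun n j => isZero_tor_of_flat _ _ _) (n + 1)
    obtain ⟨b⟩ := nonempty_tor_symm (ModuleCat.of R (C →ₗ[R] M)) C (n + 1)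
    have h0 := (hM.tor_eq_zero (n + 1) (by omega)).of_iso
      ((homologyTensorRightIso _ _ _).symm ≪≫ a ≪≫ b)
    rw [← HomologicalComplex.exactAt_iff_isZero_homology] at h0
    have h1 := h0.of_iso e
    rw [HomologicalComplex.exactAt_iff' _ (n + 2) (n + 1) n (by simp) (by simp)] at h1
    exact (ShortComplex.ShortExact.moduleCat_exact_iff_function_exact _).1 h1

end

/-! ### Proper resolutions and relative Tor. -/

variable {C M N : ModuleCat.{u} R} {𝒳 : ObjectProperty (ModuleCat.{u} R)}

/-- A proper resolution becomes a resolution under `Hom_R(C, -)` as soon as `C` is in the class. -/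
theorem ProperResolution.isResolution_homComplex (Q : ProperResolution 𝒳 M) (hC : 𝒳 C) :
    IsResolution (homComplex C Q.complex) ((homFunctor C).map Q.aug) where
  surjective f := by
    obtain ⟨g, hg⟩ := Q.hom_exact_aug C hC (ModuleCat.ofHom f)
    exact ⟨g.hom, congrArg ModuleCat.Hom.hom hg⟩
  exact_zero f := by
    constructor
    · intro hf
      obtain ⟨g, hg⟩ := Q.hom_exact_zero C hC (ModuleCat.ofHom f) (ModuleCat.hom_ext hf)
      exact ⟨g.hom, congrArg ModuleCat.Hom.hom hg⟩
    · rintro ⟨g, rfl⟩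
      exact congrArg ModuleCat.Hom.hom
        (show ModuleCat.ofHom g ≫ Q.complex.d 1 0 ≫ Q.aug = 0 by rw [Q.d_comp_aug, comp_zero])
  exact_succ n f := by
    constructor
    · intro hf
      obtain ⟨g, hg⟩ := Q.hom_exact_succ C hC n (ModuleCat.ofHom f) (ModuleCat.hom_ext hf)
      exact ⟨g.hom, congrArg ModuleCat.Hom.hom hg⟩
    · rintro ⟨g, rfl⟩
      exact congrArg ModuleCat.Hom.hom
        (show ModuleCat.ofHom g ≫ Q.complex.d (n + 2) (n + 1) ≫ Q.complex.d (n + 1) n = 0 by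
          rw [Q.complex.d_comp_d, comp_zero])

theorem CProjective.cFlat {X : ModuleCat.{u} R} (hX : CProjective C X) : CFlat C X := by
  obtain ⟨P, hP, e⟩ := hX
  exact ⟨P, inferInstance, e⟩

theorem cProjective_self (C : ModuleCat.{u} R) : CProjective C C :=
  ⟨ModuleCat.of R R, inferInstanceAs (Module.Projective R R), ⟨(TensorProduct.lid R C).symm⟩⟩

theorem nonempty_relTor_iso_tor [IsNoetherianRing R] (hC : IsSemidualizing C)
    (hM : BassClass C M) (hN : AuslanderClass C N) (h𝒳 : ∀ X, 𝒳 X → CFlat C X) (hC𝒳 : 𝒳 C)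
    (Q : ProperResolution 𝒳 M) (i : ℕ) :
    Nonempty (relTor Q N i ≅ ((Tor (ModuleCat.{u} R) i).obj M).obj N) := by
  have := hC.finite
  have : Module.FinitePresentation R C := Module.finitePresentation_of_finite R C
  have hQ (n : ℕ) := h𝒳 _ (Q.mem n)
  exact (hM.isResolution hC.bijective_homothety hQ
    (Q.isResolution_homComplex hC𝒳)).nonempty_homology_tensor_iso_tor N
    (fun n j => (hQ n).isZero_tor (hN.tor_eq_zero (j + 1) (by omega))) i

end RelTor

end

theorem mainTheorem11 {R : Type u} [CommRing R] [IsNoetherianRing R]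
    (C : ModuleCat.{u} R) (hC : RelTor.IsSemidualizing C)
    (M N : ModuleCat.{u} R) (hM : RelTor.BassClass C M) (hN : RelTor.AuslanderClass C N) (i : ℕ) :
    (∀ Q : RelTor.ProperResolution (RelTor.CProjective C) M,
      Nonempty (RelTor.relTor Q N i ≅ ((Tor (ModuleCat.{u} R) i).obj M).obj N)) ∧
    (∀ G : RelTor.ProperResolution (RelTor.CFlat C) M,
      Nonempty (RelTor.relTor G N i ≅ ((Tor (ModuleCat.{u} R) i).obj M).obj N)) :=
  ⟨fun Q => RelTor.nonempty_relTor_iso_tor hC hM hN (fun _ hX => hX.cFlat)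
      (RelTor.cProjective_self C) Q i,
    fun G => RelTor.nonempty_relTor_iso_tor hC hM hN (fun _ hX => hX)
      (RelTor.cProjective_self C).cFlat G i⟩
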